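/- Let $P$ be a Markov transition kernel on a measurable space $(E,\Sigma)$ which is $\psi$-irreducible for some maximal irreducibility measure $\psi$, and suppose that there are an integer $m\ge 1$, a number $\delta_m>0$ and a probability measure $\mu$ on $(E,\Sigma)$ such that \[ \delta_m\,\mu(A)\le P^m(x,A)\qquad\text{for all }x\in E,\ A\in\Sigma . \] For $x\in E$ let $r(x,\cdot)=\frac{d(\delta_m\mu)}{dP^m(x,\cdot)}$ be the Radon-Nikodym derivative. Let $(\widetilde X_n,R_n)_{n\ge1}$, with values in $E\times\{0,1\}$, be the Nummelin split chain: $(\widetilde X_n)_{n\ge 1}$ is a Markov chain with transition kernel $P$ and an arbitrary initial distribution, and for every $n\ge1$, conditionally on $\widetilde X_1,\dots,\widetilde X_{nm},R_m,R_{2m},\dots,R_{(n-1)m}$ with $\widetilde X_{nm}=x$, the joint law of the next block and the mark $R_{nm}$ is \[ \mathbb P\big(\widetilde X_{nm+1}\in dx_1,\dots,\widetilde X_{(n+1)m}\in dx_m,\ R_{nm}=1\big)= r(x,x_m)\,P(x,dx_1)P(x_1,dx_2)\cdots P(x_{m-1},dx_m), \] and the same expression with $1-r(x,x_m)$ in place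 of $r(x,x_m)$ for $R_{nm}=0$. Let \[ T_1=\inf\{n>0: R_{nm}=1\},\qquad T_2=\inf\{n>0: R_{(T_1+n)m}=1\} \] be the first two regeneration times. For a random variable $Y$ let \[ \|Y\|_{\psi_1}=\inf\{\gamma>0:\ \mathbb E[\exp(|Y|/\gamma)-1]\le 1\}, \] with $\inf\emptyset=\infty$. Then \[ \|T_1\|_{\psi_1}<\infty\qquad\text{and}\qquad \|T_2\|_{\psi_1}<\infty . \] -/

import Mathlib

open MeasureTheory ProbabilityTheory
open scoped ENNReal

noncomputable section

namespace SplitChain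

variable {E : Type*} [MeasurableSpace E] {Ω : Type*} [MeasurableSpace Ω]

/-! ### The ergodicity assumption -/

/-- `ψ` is a maximal irreducibility measure of the chain with transition kernel `P`: it is a
nontrivial irreducibility measure which dominates every other irreducibility measure. -/
structure IsMaximalIrreducibilityMeasure (P : Kernel E E) (ψ : Measure E) : Prop where
  ne_zero : ψ ≠ 0
  irreducible : Kernel.IsIrreducible ψ P
  maximal : ∀ φ : Measure E, Kernel.IsIrreducible φ P → φ ≪ ψ

/-- The uniform ergodicity assumption with parameters `m`, `δ` and `μ`: the chain is
`ψ`-irreducible for a maximal irreducibility measure `ψ`, and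
`δ μ(A) ≤ P^m(x, A)` for all states `x` and all measurable sets `A`. -/
structure UniformlyErgodic (P : Kernel E E) (m : ℕ) (δ : ℝ) (μ : Measure E) : Prop where
  exists_maximal : ∃ ψ : Measure E, IsMaximalIrreducibilityMeasure P ψ
  pos : 0 < δ
  minorization : ∀ (x : E) (A : Set E), MeasurableSet A →
    ENNReal.ofReal δ * μ A ≤ (P ^ m) x A

/-! ### Markov chains indexed by `n ≥ 1` -/

/-- The σ-algebra generated by `X 1, …, X n`. -/
abbrev chainPast (X : ℕ → Ω → E) (n : ℕ) : MeasurableSpace Ω :=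
  ⨆ i ∈ Finset.Icc 1 n, MeasurableSpace.comap (X i) inferInstance

/-- `X 1, X 2, …` is a Markov chain under `Pr` with transition kernel `P` and initial
distribution `χ`. The value `X 0` plays no role. -/
structure IsMarkovChain (P : Kernel E E) (χ : Measure E) (X : ℕ → Ω → E) (Pr : Measure Ω) :
    Prop where
  measurable : ∀ i, 1 ≤ i → Measurable (X i)
  initial : Pr.map (X 1) = χ
  markov : ∀ n, 1 ≤ n → ∀ F : Set Ω, MeasurableSet[chainPast X n] F →
    ∀ A : Set E, MeasurableSet A →
      Pr (F ∩ X (n + 1) ⁻¹' A) = ∫⁻ ω in F, P (X n ω) A ∂Pr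

/-! ### The split chain -/

/-- The law of the next `k` states of the chain, given that the current state is `x`:
`P(x, dx₁) P(x₁, dx₂) ⋯ P(x_{k-1}, dx_k)`. -/
def pathKernel (P : Kernel E E) : (k : ℕ) → Kernel E (Fin k → E)
  | 0 => Kernel.const E (Measure.dirac Fin.elim0)
  | k + 1 => (P.compProd ((pathKernel P k).prodMkLeft E)).map
      (fun p => (Fin.cons p.1 p.2 : Fin (k + 1) → E))

/-- The Radon-Nikodym derivative `r(x, y) = δ μ(dy) / P^m(x, dy)`. -/
def splitDensity (P : Kernel E E) (m : ℕ) (δ : ℝ) (μ : Measure E) (x y : E) : ℝ≥0∞ :=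
  (ENNReal.ofReal δ • μ).rnDeriv ((P ^ m) x) y

/-- The conditional law, given `X_{nm} = x`, of the block `(X_{nm+1}, …, X_{(n+1)m})` together
with the mark `R_{nm}`: the block is a path of the chain started at `x`, and given a block that
ends in `y` (its coordinate `⊤ : Fin m`) the mark is `1` with probability `r(x, y)` and `0` with
probability `1 - r(x, y)`. -/
def splitTransition (P : Kernel E E) (m : ℕ) [NeZero m] (δ : ℝ) (μ : Measure E) (x : E) :
    Measure ((Fin m → E) × Fin 2) :=
  ((pathKernel P m x).withDensity (fun z => splitDensity P m δ μ x (z ⊤))).map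
      (fun z => (z, 1)) +
    ((pathKernel P m x).withDensity (fun z => 1 - splitDensity P m δ μ x (z ⊤))).map
      (fun z => (z, 0))

/-- The σ-algebra generated by `X 1, …, X (n m)` and by the marks
`R m, R (2 m), …, R ((n - 1) m)`. -/
abbrev splitPast (X : ℕ → Ω → E) (R : ℕ → Ω → Fin 2) (m n : ℕ) : MeasurableSpace Ω :=
  chainPast X (n * m) ⊔ ⨆ k ∈ Finset.Ico 1 n, MeasurableSpace.comap (R (k * m)) inferInstance

/-- The pair `(X, R)` is the Nummelin split chain, under `Pr`, of the chain with transition kernel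
`P` and initial distribution `χ`, for the minorization `δ μ ≤ P^m(x, ·)`. The marks live at the
multiples `nm`, `n ≥ 1`, of `m`. -/
structure IsSplitChain (P : Kernel E E) (χ : Measure E) (m : ℕ) [NeZero m] (δ : ℝ)
    (μ : Measure E) (X : ℕ → Ω → E) (R : ℕ → Ω → Fin 2) (Pr : Measure Ω) : Prop where
  isMarkovChain : IsMarkovChain P χ X Pr
  measurable_mark : ∀ n, 1 ≤ n → Measurable (R (n * m))
  split : ∀ n, 1 ≤ n → ∀ F : Set Ω, MeasurableSet[splitPast X R m n] F →
    ∀ B : Set ((Fin m → E) × Fin 2), MeasurableSet B →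
      Pr (F ∩ {ω | ((fun i : Fin m => X (n * m + 1 + i) ω), R (n * m) ω) ∈ B}) =
        ∫⁻ ω in F, splitTransition P m δ μ (X (n * m) ω) B ∂Pr

/-! ### Regeneration times -/

/-- `inf {n > 0 : R_{(s+n)m} = 1}`, equal to `∞` if there is no such `n` (or if `s = ∞`). -/
def waitingTime (R : ℕ → Ω → Fin 2) (m : ℕ) (s : ℕ∞) (ω : Ω) : ℕ∞ :=
  ⨅ (n : ℕ) (_ : 0 < n ∧ ∃ k : ℕ, s = k ∧ R ((k + n) * m) ω = 1), (n : ℕ∞)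

/-- The partial sums `S_i = T_1 + ⋯ + T_i` of the regeneration times, with `S_0 = 0`. -/
def regenerationSum (R : ℕ → Ω → Fin 2) (m : ℕ) : ℕ → Ω → ℕ∞
  | 0, _ => 0
  | i + 1, ω => regenerationSum R m i ω + waitingTime R m (regenerationSum R m i ω) ω

/-- The regeneration times `T_i`, for `i ≥ 1`: `T_1 = inf {n > 0 : R_{nm} = 1}` and
`T_{i+1} = inf {n > 0 : R_{(T_1 + ⋯ + T_i + n)m} = 1}`. -/
def regenerationTime (R : ℕ → Ω → Fin 2) (m i : ℕ) (ω : Ω) : ℕ∞ :=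
  waitingTime R m (regenerationSum R m (i - 1) ω) ω

/-! ### The Orlicz norm -/

/-- `ψ₁(x) = exp(x) - 1` on `[0, ∞]`. -/
def psiOne (x : ℝ≥0∞) : ℝ≥0∞ := EReal.exp (x : EReal) - 1

/-- The `ψ₁`-Orlicz norm `inf {γ > 0 : 𝔼[ψ₁(|Y| / γ)] ≤ 1}` of an extended real random variable,
equal to `∞` if there is no such `γ`. -/
def orliczNormOne (Y : Ω → EReal) (Pr : Measure Ω) : ℝ≥0∞ :=
  ⨅ (γ : ℝ) (_ : 0 < γ ∧ ∫⁻ ω, psiOne ((Y ω).abs / ENNReal.ofReal γ) ∂Pr ≤ 1), ENNReal.ofReal γ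

end SplitChain

end

/-!
The end point of a block started at `x` has law `P ^ m x`, and integrating the Radon-Nikodym
derivative of `δ μ ≤ P ^ m x` against this law gives the total mass `δ`
(`splitTransition_mark_one`). This does not depend on `x`, so each mark is `1` with probability `δ`
independently of the past (`IsSplitChain.measure_inter_mark_eq_one`). Consequently, after a finite
stopping time of the marks, the waiting time for the next mark `1` exceeds `n` with probability at
most `(1 - δ) ^ n` (`IsSplitChain.measure_lt_waitingTime_le`). This applies to `T₁`, with the
stopping time `0`, and to `T₂`, with the stopping time `T₁`, which is almost surely finite by the
first application.

Finally, a geometric tail with ratio `q < 1` bounds the `ψ₁`-norm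
(`orliczNormOne_lt_top_of_geometric_tail`): for `1 < a` and `a q < 1`, the layer-cake formula gives
`𝔼[a ^ Y - 1] ≤ ∑ (a - 1) (a q) ^ n = (a - 1) / (1 - a q)`, and this is `1` when `a = 2 / (1 + q)`.
-/

namespace SplitChain

variable {E : Type*} [MeasurableSpace E] {Ω : Type*}

/-! ### The law of a mark given the current state -/

lemma measurable_finCons (k : ℕ) :
    Measurable (fun p : E × (Fin k → E) => (Fin.cons p.1 p.2 : Fin (k + 1) → E)) := by
  refine measurable_pi_lambda _ fun i => ?_
  refine Fin.cases ?_ (fun j => ?_) i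
  · simpa using measurable_fst
  · simp only [Fin.cons_succ]; fun_prop

instance isMarkovKernel_pathKernel (P : Kernel E E) [IsMarkovKernel P] (k : ℕ) :
    IsMarkovKernel (pathKernel P k) := by
  induction k with
  | zero => rw [pathKernel]; infer_instance
  | succ k ih => rw [pathKernel]; exact Kernel.IsMarkovKernel.map _ (measurable_finCons k)

lemma lintegral_pathKernel_succ (P : Kernel E E) [IsMarkovKernel P] (k : ℕ) (x : E)
    {f : (Fin (k + 1) → E) → ℝ≥0∞} (hf : Measurable f) :
    ∫⁻ z, f z ∂(pathKernel P (k + 1) x) =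
      ∫⁻ y, ∫⁻ z, f (Fin.cons y z) ∂(pathKernel P k y) ∂(P x) := by
  rw [pathKernel, Kernel.lintegral_map _ (measurable_finCons k) _ hf,
    Kernel.lintegral_compProd (f := fun p => f (Fin.cons p.1 p.2)) _ _ _
      (hf.comp (measurable_finCons k))]
  simp

/-- The end point of a path of `k + 1` steps has law `P ^ (k + 1)`. -/
lemma lintegral_pathKernel_last (P : Kernel E E) [IsMarkovKernel P] (k : ℕ) (x : E)
    {f : E → ℝ≥0∞} (hf : Measurable f) :
    ∫⁻ z, f (z (Fin.last k)) ∂(pathKernel P (k + 1) x) = ∫⁻ y, f y ∂((P ^ (k + 1)) x) := by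
  induction k generalizing x with
  | zero =>
    rw [lintegral_pathKernel_succ P 0 x (f := fun z => f (z (Fin.last _))) (by fun_prop)]
    simp
  | succ k ih =>
    rw [lintegral_pathKernel_succ P (k + 1) x (f := fun z => f (z (Fin.last _))) (by fun_prop),
      Kernel.pow_add P (k + 1) 1, pow_one, Kernel.lintegral_comp _ _ _ hf]
    refine lintegral_congr fun y => ?_
    simp only [← ih y, ← Fin.succ_last, Fin.cons_succ]

lemma lintegral_splitDensity {P : Kernel E E} [IsMarkovKernel P] {m : ℕ} {δ : ℝ} {μ : Measure E}
    [IsProbabilityMeasure μ] (hP : UniformlyErgodic P m δ μ) (x : E) :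
    ∫⁻ y, splitDensity P m δ μ x y ∂((P ^ m) x) = ENNReal.ofReal δ := by
  -- The derivative integrates to the full mass because `δ μ ≤ P ^ m x` gives absolute continuity.
  have hle : ENNReal.ofReal δ • μ ≤ (P ^ m) x :=
    Measure.le_iff.2 fun A hA => by simpa using hP.minorization x A hA
  have : IsFiniteMeasure (ENNReal.ofReal δ • μ) := μ.smul_finite ENNReal.ofReal_ne_top
  have : IsMarkovKernel (P ^ m) := by
    clear hle hP
    induction m with
    | zero => exact inferInstanceAs (IsMarkovKernel Kernel.id)
    | succ k ih => rw [Kernel.pow_add, pow_one]; infer_instance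
  simp only [splitDensity]
  rw [Measure.lintegral_rnDeriv (Measure.absolutelyContinuous_of_le hle)]
  simp

/-- Whatever the current state, the mark is `1` with probability exactly `δ`. -/
lemma splitTransition_mark_one {P : Kernel E E} [IsMarkovKernel P] {m : ℕ} [NeZero m] {δ : ℝ}
    {μ : Measure E} [IsProbabilityMeasure μ] (hP : UniformlyErgodic P m δ μ) (x : E) :
    splitTransition P m δ μ x (Prod.snd ⁻¹' {1}) = ENNReal.ofReal δ := by
  have h1 : (fun z : Fin m → E => (z, (1 : Fin 2))) ⁻¹' (Prod.snd ⁻¹' {1}) = Set.univ := by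
    ext; simp
  have h0 : (fun z : Fin m → E => (z, (0 : Fin 2))) ⁻¹' (Prod.snd ⁻¹' {1}) = ∅ := by
    ext; simp
  have hs : MeasurableSet (Prod.snd ⁻¹' {1} : Set ((Fin m → E) × Fin 2)) :=
    measurable_snd (measurableSet_singleton _)
  rw [splitTransition, Measure.add_apply, Measure.map_apply (by fun_prop) hs,
    Measure.map_apply (by fun_prop) hs, h1, h0, measure_empty, add_zero,
    withDensity_apply _ MeasurableSet.univ, Measure.restrict_univ]
  obtain ⟨k, rfl⟩ := Nat.exists_eq_succ_of_ne_zero (NeZero.ne m)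
  exact (lintegral_pathKernel_last P k x (Measure.measurable_rnDeriv _ _)).trans
    (lintegral_splitDensity hP x)

/-! ### Events in the past of the marks -/

lemma splitPast_mono (X : ℕ → Ω → E) (R : ℕ → Ω → Fin 2) (m : ℕ) :
    Monotone (splitPast X R m) := by
  intro a b hab
  refine sup_le_sup (biSup_mono fun i hi => ?_) (biSup_mono fun i hi => ?_)
  · exact Finset.Icc_subset_Icc_right (Nat.mul_le_mul_right m hab) hi
  · exact Finset.Ico_subset_Ico_right hab hi

lemma measurableSet_splitPast_mark (X : ℕ → Ω → E) (R : ℕ → Ω → Fin 2) (m : ℕ) {i n : ℕ}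
    (hi : 1 ≤ i) (hin : i < n) (s : Set (Fin 2)) :
    MeasurableSet[splitPast X R m n] (R (i * m) ⁻¹' s) := by
  have h : MeasurableSpace.comap (R (i * m)) inferInstance ≤ splitPast X R m n :=
    le_sup_of_le_right (le_iSup₂_of_le i (Finset.mem_Ico.2 ⟨hi, hin⟩) le_rfl)
  exact h _ ⟨s, MeasurableSet.of_discrete, rfl⟩

/-- The event that the `n` marks following the time `k m` all vanish. -/
def noMark (R : ℕ → Ω → Fin 2) (m k n : ℕ) : Set Ω :=
  {ω | ∀ j, 1 ≤ j → j ≤ n → R ((k + j) * m) ω ≠ 1}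

lemma noMark_zero (R : ℕ → Ω → Fin 2) (m k : ℕ) : noMark R m k 0 = Set.univ :=
  Set.eq_univ_of_forall fun _ _ h1 h0 => by omega

lemma noMark_succ (R : ℕ → Ω → Fin 2) (m k n : ℕ) :
    noMark R m k (n + 1) = noMark R m k n ∩ R ((k + n + 1) * m) ⁻¹' {1}ᶜ := by
  ext ω
  refine ⟨fun h => ⟨fun j h1 hj => h j h1 (by omega), h (n + 1) (by omega) le_rfl⟩,
    fun h j h1 hj => ?_⟩
  rcases Nat.le_succ_iff.1 hj with hj | rfl
  · exact h.1 j h1 hj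
  · exact h.2

lemma measurableSet_noMark (X : ℕ → Ω → E) (R : ℕ → Ω → Fin 2) (m k n : ℕ) :
    MeasurableSet[splitPast X R m (k + n + 1)] (noMark R m k n) := by
  induction n with
  | zero => rw [noMark_zero]; exact MeasurableSet.univ
  | succ n ih =>
    rw [noMark_succ]
    exact MeasurableSet.inter (splitPast_mono X R m (by omega) _ ih)
      (measurableSet_splitPast_mark X R m (by omega) (by omega) _)

lemma coe_lt_waitingTime_coe_iff (R : ℕ → Ω → Fin 2) (m n k : ℕ) (ω : Ω) :
    (n : ℕ∞) < waitingTime R m k ω ↔ ω ∈ noMark R m k n := by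
  rw [← ENat.add_one_le_iff (ENat.natCast_ne_top n), waitingTime]
  simp only [le_iInf_iff, noMark, Set.mem_ofPred_eq]
  constructor
  · intro h j h1 hj hR
    have := h j ⟨h1, k, rfl, hR⟩
    norm_cast at this
    omega
  · rintro h j ⟨h1, k', hk, hR⟩
    obtain rfl : k = k' := by exact_mod_cast hk
    by_contra hlt
    refine h j h1 ?_ hR
    norm_cast at hlt
    omega

/-- The waiting time for the first mark `1` is a stopping time: `T₁ = k` is decided by the marks up
to `R (k * m)`, which belong to the past with index `k + 1`. -/
lemma measurableSet_waitingTime_zero_eq (X : ℕ → Ω → E) (R : ℕ → Ω → Fin 2) (m k : ℕ) :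
    MeasurableSet[splitPast X R m (k + 1)] {ω | waitingTime R m 0 ω = k} := by
  have hlt (n : ℕ) (ω : Ω) : (n : ℕ∞) < waitingTime R m 0 ω ↔ ω ∈ noMark R m 0 n := by
    exact_mod_cast coe_lt_waitingTime_coe_iff R m n 0 ω
  have hmeas {n : ℕ} (hn : n ≤ k) : MeasurableSet[splitPast X R m (k + 1)] (noMark R m 0 n) :=
    splitPast_mono X R m (by omega) _ (measurableSet_noMark X R m 0 n)
  have hk : {ω | waitingTime R m 0 ω = k} =
      (⋂ n ∈ Finset.range k, noMark R m 0 n) \ noMark R m 0 k := by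
    ext ω
    simp only [Set.mem_sdiff, Set.mem_iInter, Finset.mem_range, ← hlt, not_lt, Set.mem_ofPred_eq]
    constructor
    · intro h
      exact ⟨fun n hn => by rw [h]; exact_mod_cast hn, h.le⟩
    · rintro ⟨h1, h2⟩
      refine le_antisymm h2 ?_
      cases k with
      | zero => simp
      | succ k => exact_mod_cast Order.add_one_le_of_lt (h1 k (by omega))
  rw [hk]
  exact MeasurableSet.diff (Finset.measurableSet_biInter _ fun n hn =>
    hmeas (Finset.mem_range.1 hn).le) (hmeas le_rfl)

/-! ### Independence of the mark from the past -/

section Marks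

variable [MeasurableSpace Ω] {P : Kernel E E} {χ μ : Measure E} {m : ℕ} [NeZero m] {δ : ℝ}
  {X : ℕ → Ω → E} {R : ℕ → Ω → Fin 2} {Pr : Measure Ω}

lemma IsSplitChain.measure_inter_mark_eq_one [IsMarkovKernel P] [IsProbabilityMeasure μ]
    (hP : UniformlyErgodic P m δ μ) (hXR : IsSplitChain P χ m δ μ X R Pr) {n : ℕ} (hn : 1 ≤ n)
    {F : Set Ω} (hF : MeasurableSet[splitPast X R m n] F) :
    Pr (F ∩ R (n * m) ⁻¹' {1}) = Pr F * ENNReal.ofReal δ := by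
  have h := hXR.split n hn F hF (Prod.snd ⁻¹' {1}) (measurable_snd (measurableSet_singleton _))
  simp only [splitTransition_mark_one hP, setLIntegral_const] at h
  rw [mul_comm (Pr F), ← h]
  rfl

lemma IsSplitChain.measure_inter_mark_ne_one [IsMarkovKernel P] [IsProbabilityMeasure μ]
    [IsFiniteMeasure Pr]
    (hP : UniformlyErgodic P m δ μ) (hXR : IsSplitChain P χ m δ μ X R Pr) {n : ℕ} (hn : 1 ≤ n)
    {F : Set Ω} (hF : MeasurableSet[splitPast X R m n] F) :
    Pr (F ∩ R (n * m) ⁻¹' {1}ᶜ) = Pr F * (1 - ENNReal.ofReal δ) := by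
  have h := measure_inter_add_sdiff (μ := Pr) F
    (hXR.measurable_mark n hn (measurableSet_singleton 1))
  rw [hXR.measure_inter_mark_eq_one hP hn hF, Set.sdiff_eq, ← Set.preimage_compl] at h
  rw [ENNReal.mul_sub (fun _ _ => measure_ne_top _ _), mul_one]
  refine ENNReal.eq_sub_of_add_eq ?_ (by rw [add_comm, h])
  exact ENNReal.mul_ne_top (measure_ne_top _ _) ENNReal.ofReal_ne_top

lemma IsSplitChain.splitPast_le (hXR : IsSplitChain P χ m δ μ X R Pr) (n : ℕ) :
    splitPast X R m n ≤ ‹MeasurableSpace Ω› :=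
  sup_le
    (iSup₂_le fun i hi => (hXR.isMarkovChain.measurable i (Finset.mem_Icc.1 hi).1).comap_le)
    (iSup₂_le fun i hi => (hXR.measurable_mark i (Finset.mem_Ico.1 hi).1).comap_le)

/-! ### The geometric tail of the waiting times -/

lemma IsSplitChain.measure_inter_noMark [IsMarkovKernel P] [IsProbabilityMeasure μ]
    [IsFiniteMeasure Pr]
    (hP : UniformlyErgodic P m δ μ) (hXR : IsSplitChain P χ m δ μ X R Pr) {k : ℕ} (n : ℕ)
    {F : Set Ω} (hF : MeasurableSet[splitPast X R m (k + 1)] F) :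
    Pr (F ∩ noMark R m k n) = Pr F * (1 - ENNReal.ofReal δ) ^ n := by
  induction n with
  | zero => simp [noMark_zero]
  | succ n ih =>
    rw [noMark_succ, ← Set.inter_assoc, hXR.measure_inter_mark_ne_one hP (by omega), ih, pow_succ,
      mul_assoc]
    exact MeasurableSet.inter (splitPast_mono X R m (by omega) _ hF)
      (measurableSet_noMark X R m k n)

/-- After any almost surely finite stopping time `s` of the marks, the waiting time for the next
mark `1` has a geometric tail. The past with index `k + 1` contains the marks up to `R (k * m)`
inclusive, so `hs` says that `s = k` is decided by time `k m`. -/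
lemma IsSplitChain.measure_lt_waitingTime_le [IsMarkovKernel P] [IsProbabilityMeasure μ]
    [IsProbabilityMeasure Pr]
    (hP : UniformlyErgodic P m δ μ) (hXR : IsSplitChain P χ m δ μ X R Pr) {s : Ω → ℕ∞}
    (hs : ∀ k : ℕ, MeasurableSet[splitPast X R m (k + 1)] {ω | s ω = k})
    (htop : Pr {ω | s ω = ⊤} = 0) (n : ℕ) :
    Pr {ω | (n : ℕ∞) < waitingTime R m (s ω) ω} ≤ (1 - ENNReal.ofReal δ) ^ n := by
  set q := 1 - ENNReal.ofReal δ
  have hsub : {ω | (n : ℕ∞) < waitingTime R m (s ω) ω} ⊆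
      {ω | s ω = ⊤} ∪ ⋃ k : ℕ, {ω | s ω = k} ∩ noMark R m k n := by
    intro ω hω
    rcases eq_or_ne (s ω) ⊤ with h | h
    · exact Or.inl h
    · obtain ⟨k, hk⟩ := ENat.ne_top_iff_exists.1 h
      refine Or.inr (Set.mem_iUnion.2 ⟨k, hk.symm, ?_⟩)
      rw [Set.mem_ofPred_eq, ← hk] at hω
      exact (coe_lt_waitingTime_coe_iff R m n k ω).1 hω
  have hdisj : Pairwise (Function.onFun Disjoint fun k : ℕ => {ω | s ω = k}) := by
    intro a b hab
    refine Set.disjoint_left.2 fun ω (ha : s ω = a) (hb : s ω = b) => hab ?_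
    exact_mod_cast ha.symm.trans hb
  calc Pr {ω | (n : ℕ∞) < waitingTime R m (s ω) ω}
      ≤ Pr {ω | s ω = ⊤} + ∑' k : ℕ, Pr ({ω | s ω = k} ∩ noMark R m k n) :=
        (measure_mono hsub).trans ((measure_union_le _ _).trans
          (add_le_add_right (measure_iUnion_le _) _))
    _ = ∑' k : ℕ, Pr {ω | s ω = k} * q ^ n := by
        rw [htop, zero_add]
        exact tsum_congr fun k => hXR.measure_inter_noMark hP n (hs k)
    _ = Pr (⋃ k : ℕ, {ω | s ω = k}) * q ^ n := by
        rw [ENNReal.tsum_mul_right,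
          measure_iUnion hdisj fun k => hXR.splitPast_le (k + 1) _ (hs k)]
    _ ≤ q ^ n := mul_le_of_le_one_left' prob_le_one

end Marks

/-! ### Geometric tails and the Orlicz norm -/

/-- The layer-cake bound `a ^ y - 1 ≤ ∑ (a - 1) a ^ n 𝟙{n < y}`, where `a ^ y = exp (y / γ)` for
`γ = 1 / log a`. -/
lemma psiOne_div_inv_log_le {a : ℝ} (ha : 1 < a) (y : ℕ∞) :
    psiOne ((((y : ℝ≥0∞) : EReal)).abs / ENNReal.ofReal (Real.log a)⁻¹) ≤
      ∑' n : ℕ, ENNReal.ofReal ((a - 1) * a ^ n) * {k : ℕ∞ | n < k}.indicator 1 y := by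
  have hlog : 0 < Real.log a := Real.log_pos ha
  induction y using ENat.recTopCoe with
  | top =>
    refine le_top.trans_eq (Eq.symm ?_)
    refine top_le_iff.1 ((ENNReal.tsum_const_eq_top_of_ne_zero (α := ℕ)
      (c := ENNReal.ofReal (a - 1)) (by simpa using ha)).symm.trans_le
      (ENNReal.tsum_le_tsum fun n => ?_))
    simp only [Set.mem_ofPred_eq, ENat.natCast_lt_top, Set.indicator_of_mem, Pi.one_apply, mul_one]
    exact ENNReal.ofReal_le_ofReal
      (le_mul_of_one_le_right (by linarith) (one_le_pow₀ ha.le))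
  | coe N =>
    have hL : psiOne (((((N : ℕ∞) : ℝ≥0∞) : EReal)).abs / ENNReal.ofReal (Real.log a)⁻¹) =
        ENNReal.ofReal (a ^ N - 1) := by
      have h1 : (((N : ℕ∞) : ℝ≥0∞) : EReal).abs = ENNReal.ofReal N := by
        have : (((N : ℕ∞) : ℝ≥0∞) : EReal) = ((N : ℝ) : EReal) := by
          simp only [ENat.toENNReal_coe]; rfl
        rw [this, EReal.abs_def, Nat.abs_cast]
      have h2 : (N : ℝ) / (Real.log a)⁻¹ = Real.log (a ^ N) := by simp
      rw [psiOne, h1, ← ENNReal.ofReal_div_of_pos (inv_pos.2 hlog), h2,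
        EReal.coe_ennreal_ofReal, max_eq_left (Real.log_nonneg (one_le_pow₀ ha.le)),
        EReal.exp_coe, Real.exp_log (by positivity), ENNReal.ofReal_sub _ zero_le_one,
        ENNReal.ofReal_one]
    rw [hL, ← mul_geom_sum, Finset.mul_sum, ENNReal.ofReal_sum_of_nonneg
      (fun n _ => mul_nonneg (by linarith) (by positivity))]
    refine le_trans (Finset.sum_le_sum fun n hn => ?_) (ENNReal.sum_le_tsum (Finset.range N))
    simp [Set.indicator, Finset.mem_range.1 hn]

/-- A geometric tail with ratio `q < 1` makes the `ψ₁`-norm finite. No measurability of `Y` is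
needed, as its superlevel sets can be replaced by measurable hulls. -/
lemma orliczNormOne_lt_top_of_geometric_tail [MeasurableSpace Ω] {Pr : Measure Ω}
    {Y : Ω → ℕ∞} {q : ℝ≥0∞} (hq : q < 1) (hY : ∀ n : ℕ, Pr {ω | (n : ℕ∞) < Y ω} ≤ q ^ n) :
    orliczNormOne (fun ω => ((Y ω : ℝ≥0∞) : EReal)) Pr < ⊤ := by
  lift q to NNReal using hq.ne_top
  have hq1 : (q : ℝ) < 1 := by exact_mod_cast hq
  have hq0 : (0 : ℝ) ≤ q := q.2
  -- The base `a` solves `(a - 1) / (1 - a q) = 1`.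
  obtain ⟨a, ha⟩ : ∃ a : ℝ, a = 2 / (1 + q) := ⟨_, rfl⟩
  have ha1 : 1 < a := by rw [ha, lt_div_iff₀ (by positivity)]; linarith
  have haq : a * q < 1 := by rw [ha, div_mul_eq_mul_div, div_lt_one (by positivity)]; linarith
  have haq0 : 0 ≤ a * q := mul_nonneg (by linarith) hq0
  refine (iInf₂_le (Real.log a)⁻¹ ⟨inv_pos.2 (Real.log_pos ha1), ?_⟩).trans_lt
    ENNReal.ofReal_lt_top
  set B : ℕ → Set Ω := fun n => toMeasurable Pr {ω | (n : ℕ∞) < Y ω}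
  calc ∫⁻ ω, psiOne ((((Y ω : ℝ≥0∞) : EReal)).abs / ENNReal.ofReal (Real.log a)⁻¹) ∂Pr
      ≤ ∫⁻ ω, ∑' n : ℕ, ENNReal.ofReal ((a - 1) * a ^ n) * (B n).indicator 1 ω ∂Pr := by
        refine lintegral_mono fun ω => (psiOne_div_inv_log_le ha1 (Y ω)).trans
          (ENNReal.tsum_le_tsum fun n => mul_le_mul_right ?_ _)
        by_cases h : (n : ℕ∞) < Y ω
        · have hB : ω ∈ B n := subset_toMeasurable _ _ h
          simp [hB, h]
        · simp [h]
    _ = ∑' n : ℕ, ENNReal.ofReal ((a - 1) * a ^ n) * Pr (B n) := by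
        have hB (n : ℕ) : MeasurableSet (B n) := measurableSet_toMeasurable _ _
        rw [lintegral_tsum fun n =>
          ((measurable_one.indicator (hB n)).const_mul _).aemeasurable]
        refine tsum_congr fun n => ?_
        rw [lintegral_const_mul _ (measurable_one.indicator (hB n)), lintegral_indicator_one (hB n)]
    _ ≤ ∑' n : ℕ, ENNReal.ofReal ((a - 1) * (a * q) ^ n) := by
        refine ENNReal.tsum_le_tsum fun n => ?_
        rw [measure_toMeasurable, mul_pow, ← mul_assoc,
          ENNReal.ofReal_mul (mul_nonneg (by linarith) (by positivity)),
          ENNReal.ofReal_pow hq0, ENNReal.ofReal_coe_nnreal]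
        exact mul_le_mul_right (hY n) _
    _ = ENNReal.ofReal ((a - 1) * (1 - a * q)⁻¹) := by
        rw [← ENNReal.ofReal_tsum_of_nonneg
          (fun n => mul_nonneg (by linarith) (pow_nonneg haq0 n))
          ((summable_geometric_of_lt_one haq0 haq).mul_left _), tsum_mul_left,
          tsum_geometric_of_lt_one haq0 haq]
    _ ≤ 1 := by
        rw [ENNReal.ofReal_le_one, ← div_eq_mul_inv, div_le_one (by linarith)]
        have : a * (1 + q) = 2 := by rw [ha]; field_simp
        linarith

end SplitChain

theorem proposition1 {E : Type*} [MeasurableSpace E] (P : Kernel E E) [IsMarkovKernel P]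
    (m : ℕ) [NeZero m] (δ : ℝ) (μ : Measure E) [IsProbabilityMeasure μ]
    (hP : SplitChain.UniformlyErgodic P m δ μ)
    {Ω : Type*} [MeasurableSpace Ω] (Pr : Measure Ω) [IsProbabilityMeasure Pr]
    (χ : Measure E) (X : ℕ → Ω → E) (R : ℕ → Ω → Fin 2)
    (hXR : SplitChain.IsSplitChain P χ m δ μ X R Pr) :
    SplitChain.orliczNormOne
        (fun ω => ((SplitChain.regenerationTime R m 1 ω : ℝ≥0∞) : EReal)) Pr < ⊤ ∧
      SplitChain.orliczNormOne
        (fun ω => ((SplitChain.regenerationTime R m 2 ω : ℝ≥0∞) : EReal)) Pr < ⊤ := by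
  have hq : 1 - ENNReal.ofReal δ < 1 :=
    ENNReal.sub_lt_self ENNReal.one_ne_top one_ne_zero (ENNReal.ofReal_pos.2 hP.pos).ne'
  have h1 : ∀ n : ℕ, Pr {ω | (n : ℕ∞) < SplitChain.waitingTime R m 0 ω} ≤
      (1 - ENNReal.ofReal δ) ^ n := by
    refine hXR.measure_lt_waitingTime_le (s := fun _ => 0) hP (fun k => ?_) (by simp)
    exact MeasurableSet.const _
  have htop : Pr {ω | SplitChain.waitingTime R m 0 ω = ⊤} = 0 := by
    refine le_antisymm (ge_of_tendsto' (ENNReal.tendsto_pow_atTop_nhds_zero_of_lt_one hq)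
      fun n => (measure_mono fun ω hω => ?_).trans (h1 n)) zero_le
    rw [Set.mem_ofPred_eq] at hω ⊢
    rw [hω]
    exact ENat.natCast_lt_top n
  have hT1 : SplitChain.regenerationTime R m 1 = SplitChain.waitingTime R m 0 := by
    ext1 ω; rfl
  have hT2 : SplitChain.regenerationTime R m 2 =
      fun ω => SplitChain.waitingTime R m (SplitChain.waitingTime R m 0 ω) ω := by
    ext1 ω
    simp [SplitChain.regenerationTime, SplitChain.regenerationSum]
  rw [hT1, hT2]
  exact ⟨SplitChain.orliczNormOne_lt_top_of_geometric_tail hq h1,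
    SplitChain.orliczNormOne_lt_top_of_geometric_tail hq
      (hXR.measure_lt_waitingTime_le hP
        (SplitChain.measurableSet_waitingTime_zero_eq X R m) htop)⟩
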